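/- Let $\mathcal A$ be a finite alphabet with $k=\#\mathcal A$ letters, and let $\mathbf u=u_0u_1u_2\cdots$ be an infinite word over $\mathcal A$ in which every letter of $\mathcal A$ occurs. Let $\mathcal L(\mathbf u)$ be the set of all finite factors of $\mathbf u$ (including the empty word). For a finite word $w$ let $|w|$ be its length and $\overline w$ its reversal; $w$ is a palindrome if $w=\overline w$. For $n\in\mathbb N=\{0,1,2,\dots\}$ let $\mathcal C(n)$ be the number of factors of $\mathbf u$ of length $n$, and $\mathcal P(n)$ the number of palindromic factors of $\mathbf u$ of length $n$. For $w\in\mathcal L(\mathbf u)$ put $$\mathrm{Lext}(w)=\{a\in\mathcal A: aw\in\mathcal L(\mathbf u)\},\qquad \mathrm{Rext}(w)=\{b\in\mathcal A: wb\in\mathcal L(\mathbf u)\},$$ $$\mathrm{Bext}(w)=\{awb\in\mathcal L(\mathbf u): a,b\in\mathcal A\},\qquad \mathrm b(w)=\#\mathrm{Bext}(w)-\#\mathrm{Rext}(w)-\#\mathrm{Lext}(w)+1,$$ and, if $w$ is a palindrome, $\mathrm{Pext}(w)=\{awa\in\mathcal L(\mathbf u): a\in\mathcal A\}$. A factor $w$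 is bispecial if $\#\mathrm{Lext}(w)\ge 2$ and $\#\mathrm{Rext}(w)\ge 2$. The word $\mathbf u$ is rich if every factor $w$ of $\mathbf u$ contains exactly $|w|+1$ distinct palindromes (counting the empty word) as factors. Assume that $\mathcal L(\mathbf u)$ is closed under reversal (that is, $w\in\mathcal L(\mathbf u)$ implies $\overline w\in\mathcal L(\mathbf u)$) and that $\mathcal C(n)=(k-1)n+1$ for all $n\in\mathbb N$. Then: 1. $\mathcal P(n)+\mathcal P(n+1)=k+1$ holds for all $n\in\mathbb N$ if and only if every bispecial factor $w$ of $\mathbf u$ satisfies $\mathrm b(w)=0$ when $w$ is not a palindrome, and $\mathrm b(w)=\#\mathrm{Pext}(w)-1$ when $w$ is a palindrome. 2. $\mathcal P(n)+\mathcal P(n+1)=k+1$ holds for all $n\in\mathbb N$ if and only if $\mathbf u$ is rich. -/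

import Mathlib

namespace InfWord

variable {A : Type*}

/-- The language of an infinite word `u = u₀u₁u₂…`: the set of all its (finite) factors
`uᵢuᵢ₊₁…uᵢ₊ₙ₋₁`, the empty word included. -/
def language (u : ℕ → A) : Set (List A) :=
  {w | ∃ i : ℕ, w = (List.range w.length).map fun j => u (i + j)}

/-- The language contains with every factor also its reversal. -/
def ClosedUnderReversal (u : ℕ → A) : Prop :=
  ∀ w ∈ language u, w.reverse ∈ language u

/-- Factor complexity: the number of factors of length `n`. -/
noncomputable def factorComplexity (u : ℕ → A) (n : ℕ) : ℕ :=
  {w | w ∈ language u ∧ w.length = n}.ncard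

/-- Palindromic complexity: the number of palindromic factors of length `n`. -/
noncomputable def palComplexity (u : ℕ → A) (n : ℕ) : ℕ :=
  {w | w ∈ language u ∧ w.length = n ∧ w.Palindrome}.ncard

/-- Left extensions of `w`: letters `a` with `aw` a factor. -/
def Lext (u : ℕ → A) (w : List A) : Set A :=
  {a | a :: w ∈ language u}

/-- Right extensions of `w`: letters `b` with `wb` a factor. -/
def Rext (u : ℕ → A) (w : List A) : Set A :=
  {b | w ++ [b] ∈ language u}

/-- Bilateral extensions of `w`: factors of the form `awb` with letters `a`, `b`. -/
def Bext (u : ℕ → A) (w : List A) : Set (List A) :=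
  {v | v ∈ language u ∧ ∃ a b : A, v = a :: (w ++ [b])}

/-- Palindromic extensions of a palindrome `w`: factors of the form `awa` with a letter `a`. -/
def Pext (u : ℕ → A) (w : List A) : Set (List A) :=
  {v | v ∈ language u ∧ ∃ a : A, v = a :: (w ++ [a])}

/-- Bilateral order `b(w) = #Bext(w) - #Rext(w) - #Lext(w) + 1`. -/
noncomputable def bilateralOrder (u : ℕ → A) (w : List A) : ℤ :=
  (Bext u w).ncard - (Rext u w).ncard - (Lext u w).ncard + 1

/-- A factor with at least two left extensions and at least two right extensions. -/
def IsBispecial (u : ℕ → A) (w : List A) : Prop :=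
  w ∈ language u ∧ 2 ≤ (Lext u w).ncard ∧ 2 ≤ (Rext u w).ncard

/-- Every factor `w` contains exactly `|w| + 1` distinct palindromes (the empty word included). -/
def IsRich (u : ℕ → A) : Prop :=
  ∀ w ∈ language u, {p : List A | p <:+: w ∧ p.Palindrome}.ncard = w.length + 1

/-- Property `C`: the factor complexity is `(k - 1) n + 1`, with `k` the size of the alphabet. -/
def PropertyC [Fintype A] (u : ℕ → A) : Prop :=
  ∀ n : ℕ, (factorComplexity u n : ℤ) = ((Fintype.card A : ℤ) - 1) * n + 1

/-- Property `P`: `P(n) + P(n + 1) = k + 1`, with `k` the size of the alphabet. -/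
def PropertyP [Fintype A] (u : ℕ → A) : Prop :=
  ∀ n : ℕ, palComplexity u n + palComplexity u (n + 1) = Fintype.card A + 1

end InfWord

/-! A return is the stretch of `u` from an occurrence of a factor to the next occurrence of it or
its reversal. Everything is compared with one condition: all returns are palindromes
(`PalindromicReturns`).

This is equivalent to richness (`isRich_iff_palindromicReturns`): each letter read may create only
one new palindrome, the longest palindromic suffix, and that suffix is new exactly when no
non-palindromic return is in the way.

For property P, take the graph whose vertices are the factors of length n and whose edges are the
non-palindromic factors of length n + 1, both up to reversal. It is connected, with (C(n) + P(n))/2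
vertices and (C(n+1) - P(n+1))/2 edges. Hence P(n) + P(n+1) ≤ C(n+1) - C(n) + 2 = k + 1, with
equality exactly when this multigraph is a tree. A return whose end edges are not mirror images
would close a cycle (`PropertyP.window_eq_reverse_of_isReturn`); if returns are palindromes, each
new edge leads to a new vertex (`PalindromicReturns.factorComplexity_succ_add_two_le`).

For bilateral orders, palindromic returns make the graph of extensions of `w` connected, which gives
`palOrder u w ≤ bilateralOrder u w`. Over the factors of length n these sum to P(n+2) - P(n) and to
the second difference of C, which is 0. Under P both sums vanish, so equality holds for each `w`.
Conversely, equality on bispecial factors (it is automatic on others) gives P(n+2) = P(n), and P(0)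
+ P(1) = k + 1. -/

namespace InfWord

variable {A : Type*}

/-! ### Factors as windows -/

/-- The factor of length `n` of `u` that starts at position `i`. -/
def window (u : ℕ → A) (i n : ℕ) : List A :=
  (List.range n).map fun j => u (i + j)

@[simp]
theorem length_window (u : ℕ → A) (i n : ℕ) : (window u i n).length = n := by
  simp [window]

theorem window_mem_language (u : ℕ → A) (i n : ℕ) : window u i n ∈ language u :=
  ⟨i, by simp [window]⟩

theorem mem_language_iff {u : ℕ → A} {w : List A} :
    w ∈ language u ↔ ∃ i, w = window u i w.length :=
  Iff.rfl

theorem window_eq_iff {u : ℕ → A} {i j n : ℕ} :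
    window u i n = window u j n ↔ ∀ p < n, u (i + p) = u (j + p) := by
  simp [window]

theorem window_eq_reverse_iff {u : ℕ → A} {i j n : ℕ} :
    window u i n = (window u j n).reverse ↔ ∀ p < n, u (i + p) = u (j + (n - 1 - p)) := by
  constructor
  · intro h p hp
    have := congrArg (fun l => l[p]?) h
    simpa [window, hp, List.getElem?_reverse, show n - 1 - p < n by omega] using this
  · intro h
    apply List.ext_getElem (by simp)
    intro p hp _
    have hp' : p < n := by simpa using hp
    simpa [window] using h p hp'

theorem window_add (u : ℕ → A) (i m n : ℕ) :
    window u i (m + n) = window u i m ++ window u (i + m) n := by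
  simp [window, List.range_add, Function.comp_def, add_assoc]

theorem window_succ_left (u : ℕ → A) (i n : ℕ) :
    window u i (n + 1) = u i :: window u (i + 1) n := by
  rw [add_comm, window_add]
  simp [window]

theorem window_succ_right (u : ℕ → A) (i n : ℕ) :
    window u i (n + 1) = window u i n ++ [u (i + n)] := by
  rw [window_add]
  simp [window]

theorem infix_window_iff {u : ℕ → A} {i m : ℕ} {p : List A} :
    p <:+: window u i m ↔ ∃ s, i ≤ s ∧ s + p.length ≤ i + m ∧ p = window u s p.length := by
  constructor
  · rintro ⟨a, b, h⟩
    have hl := congrArg List.length h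
    simp only [List.length_append, length_window] at hl
    refine ⟨i + a.length, by omega, by omega, ?_⟩
    rw [← hl, window_add, window_add] at h
    obtain ⟨h1, -⟩ := List.append_inj h (by simp)
    exact (List.append_inj h1 (by simp)).2
  · rintro ⟨s, hs, hl, hp⟩
    obtain ⟨a, rfl⟩ := Nat.exists_eq_add_of_le hs
    obtain ⟨b, hb⟩ := Nat.exists_eq_add_of_le hl
    have hm : m = a + p.length + b := by omega
    refine ⟨window u i a, window u (i + (a + p.length)) b, ?_⟩
    rw [hm, window_add, window_add, ← hp]

theorem mem_language_of_infix {u : ℕ → A} {v w : List A} (hw : w ∈ language u)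
    (h : v <:+: w) : v ∈ language u := by
  obtain ⟨i, hi⟩ := hw
  change w = window u i _ at hi
  rw [hi, infix_window_iff] at h
  obtain ⟨s, -, -, hs⟩ := h
  exact ⟨s, hs⟩

theorem finite_language_length [Finite A] (u : ℕ → A) (n : ℕ) :
    {w | w ∈ language u ∧ w.length = n}.Finite :=
  (List.finite_length_eq A n).subset fun _ h => h.2

/-! ### Richness and palindromic returns -/

/-- `v` is `w` or the reversal of `w`. -/
def Mirror (v w : List A) : Prop :=
  v = w ∨ v = w.reverse

theorem Mirror.symm {v w : List A} (h : Mirror v w) : Mirror w v := by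
  rcases h with rfl | rfl
  · exact Or.inl rfl
  · exact Or.inr (by simp)

theorem Mirror.trans {v w x : List A} (h : Mirror v w) (h' : Mirror w x) : Mirror v x := by
  rcases h with rfl | rfl <;> rcases h' with rfl | rfl <;> simp [Mirror]

/-- The factor of length `n` at position `i` occurs, up to reversal, at position `i + d`, and at no
position strictly between. -/
structure IsReturn (u : ℕ → A) (n i d : ℕ) : Prop where
  pos : 0 < d
  mirror : Mirror (window u (i + d) n) (window u i n)
  first : ∀ t, 0 < t → t < d → ¬ Mirror (window u (i + t) n) (window u i n)

/-- Every factor that leads from `w` to the next occurrence of `w` or its reversal is a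
palindrome. -/
def PalindromicReturns (u : ℕ → A) : Prop :=
  ∀ n i d, IsReturn u n i d → (window u i (d + n)).Palindrome

theorem palindrome_window_iff {u : ℕ → A} {i n : ℕ} :
    (window u i n).Palindrome ↔ ∀ p < n, u (i + p) = u (i + (n - 1 - p)) := by
  rw [List.Palindrome.iff_reverse_eq, eq_comm, window_eq_reverse_iff]

theorem finite_palindromic_infixes (w : List A) : {p : List A | p <:+: w ∧ p.Palindrome}.Finite :=
  w.sublists.finite_toSet.subset fun p hp => by simpa using hp.1.sublist

/-- The last letter of the return must create a new palindrome, necessarily a suffix; this suffix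
turns out to be the whole return. -/
theorem IsRich.palindromicReturns {u : ℕ → A} (h : IsRich u) : PalindromicReturns u := by
  intro n i d hr
  obtain ⟨e, rfl⟩ : ∃ e, d = e + 1 := ⟨d - 1, by have := hr.pos; omega⟩
  have h1 := h _ (window_mem_language u i (e + 1 + n))
  have h2 := h _ (window_mem_language u i (e + n))
  rw [length_window] at h1 h2
  have hlt : {p : List A | p <:+: window u i (e + n) ∧ p.Palindrome}.ncard <
      {p : List A | p <:+: window u i (e + 1 + n) ∧ p.Palindrome}.ncard := by
    rw [h1, h2]; omega
  obtain ⟨p, ⟨hp1, hpal⟩, hp2⟩ :=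
    Set.exists_mem_notMem_of_ncard_lt_ncard hlt (finite_palindromic_infixes _)
  have hp2 : ¬ p <:+: window u i (e + n) := fun h => hp2 ⟨h, hpal⟩
  rw [infix_window_iff] at hp1 hp2
  obtain ⟨s, hs, hl, hp⟩ := hp1
  generalize p.length = m at *
  subst hp
  have hs' : s + m = i + (e + 1 + n) := by
    by_contra hne
    exact hp2 ⟨s, hs, by omega, rfl⟩
  rw [palindrome_window_iff] at hpal
  -- If `m ≤ n`, the palindrome lies in the final window and so already occurs in its mirror image
  -- at `i`. If `m > n`, it starts with a mirror copy of that window, which can only be the one at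
  -- `i`.
  rcases le_or_gt m n with hmn | hmn
  · exfalso
    rcases hr.mirror with hm | hm
    · rw [window_eq_iff] at hm
      refine hp2 ⟨i + (n - m), by omega, by omega, ?_⟩
      rw [window_eq_iff]
      intro p hp
      have := hm (n - m + p) (by omega)
      rw [show i + (e + 1) + (n - m + p) = s + p by omega] at this
      rw [this]; congr 1; omega
    · rw [window_eq_reverse_iff] at hm
      refine hp2 ⟨i, by omega, by omega, ?_⟩
      rw [window_eq_iff]
      intro p hp
      rw [hpal p hp]
      have := hm (n - 1 - p) (by omega)
      rw [show i + (e + 1) + (n - 1 - p) = s + (m - 1 - p) by omega] at this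
      rw [this]; congr 1; omega
  · have key : Mirror (window u s n) (window u i n) := by
      refine Mirror.trans (Or.inr ?_) hr.mirror
      rw [window_eq_reverse_iff]
      intro p hp
      rw [hpal p (by omega)]; congr 1; omega
    rcases hs.eq_or_lt with rfl | hlt
    · rw [show e + 1 + n = m by omega, palindrome_window_iff]
      exact hpal
    · refine absurd key ?_
      have := hr.first (s - i) (by omega) (by omega)
      rwa [show i + (s - i) = s by omega] at this

theorem PalindromicReturns.ncard_palindromic_infixes {u : ℕ → A} (h : PalindromicReturns u)
    (i m : ℕ) : {p : List A | p <:+: window u i m ∧ p.Palindrome}.ncard = m + 1 := by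
  classical
  induction m with
  | zero =>
    have : {p : List A | p <:+: window u i 0 ∧ p.Palindrome} = {[]} := by
      ext p
      simp only [window, List.range_zero, List.map_nil, List.infix_nil, Set.mem_ofPred_eq,
        Set.mem_singleton_iff, and_iff_left_iff_imp]
      rintro rfl
      exact List.Palindrome.nil
    rw [this]; simp
  | succ m ih =>
    -- The least `l` gives the longest palindromic suffix; it is the unique palindrome added by the
    -- last letter.
    have hex : ∃ l, l ≤ m ∧ (window u (i + l) (m + 1 - l)).Palindrome :=
      ⟨m, le_rfl, by
        rw [show m + 1 - m = 1 by omega]; simpa [window] using List.Palindrome.singleton _⟩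
    obtain ⟨hlm, hpal⟩ := Nat.find_spec hex
    have hmin := fun l hl => Nat.find_min hex (m := l) hl
    generalize Nat.find hex = l at *
    have hnot : window u (i + l) (m + 1 - l) ∉
        {p : List A | p <:+: window u i m ∧ p.Palindrome} := by
      rintro ⟨hinf, -⟩
      rw [infix_window_iff, length_window] at hinf
      -- The least `r` gives the latest earlier occurrence, hence a return; being a palindrome, that
      -- return would be a longer palindromic suffix.
      have hex' : ∃ r, 0 < r ∧ r ≤ l ∧
          window u (i + l) (m + 1 - l) = window u (i + l - r) (m + 1 - l) := by
        obtain ⟨s, hs1, hs2, hs3⟩ := hinf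
        exact ⟨i + l - s, by omega, by omega, by rw [hs3]; congr 1; omega⟩
      obtain ⟨hr0, hrl, hr⟩ := Nat.find_spec hex'
      have hrmin := fun r hr => Nat.find_min hex' (m := r) hr
      generalize Nat.find hex' = r at *
      have := h (m + 1 - l) (i + l - r) r
        ⟨hr0, Or.inl (by rw [← hr]; congr 1; omega), fun t ht0 htr hmir => by
          have hpal' : (window u (i + l) (m + 1 - l)).reverse = window u (i + l) (m + 1 - l) :=
            hpal.reverse_eq
          have : window u (i + l - r + t) (m + 1 - l) = window u (i + l) (m + 1 - l) := by
            rcases hmir with hm | hm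
            · rw [hm, ← hr]
            · rw [hm, ← hr, hpal']
          refine hrmin (r - t) (by omega) ⟨by omega, by omega, ?_⟩
          rw [← this]; congr 1; omega⟩
      refine hmin (l - r) (by omega) ⟨by omega, ?_⟩
      convert this using 2 <;> omega
    have hset : {p : List A | p <:+: window u i (m + 1) ∧ p.Palindrome} =
        insert (window u (i + l) (m + 1 - l))
          {p : List A | p <:+: window u i m ∧ p.Palindrome} := by
      ext q
      simp only [Set.mem_ofPred_eq, Set.mem_insert_iff]
      constructor
      · rintro ⟨hq, hqp⟩
        by_cases hq' : q <:+: window u i m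
        · exact Or.inr ⟨hq', hqp⟩
        left
        rw [infix_window_iff] at hq hq'
        obtain ⟨s, hs1, hs2, hs3⟩ := hq
        generalize q.length = k at *
        subst hs3
        have hsk : s + k = i + (m + 1) := by
          by_contra hne
          exact hq' ⟨s, hs1, by omega, rfl⟩
        have hk0 : 0 < k := by
          by_contra hk0
          obtain rfl : k = 0 := by omega
          exact hq' ⟨i, le_rfl, by omega, by simp [window]⟩
        rcases lt_trichotomy s (i + l) with hlt | rfl | hgt
        · refine absurd ?_ (hmin (s - i) (by omega))
          refine ⟨by omega, ?_⟩
          convert hqp using 2 <;> omega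
        · congr 1; omega
        -- A shorter palindromic suffix is reflected inside the longest one onto a prefix of it,
        -- which ends before the last letter.
        · exfalso
          refine hq' ⟨i + l, by omega, by omega, ?_⟩
          rw [palindrome_window_iff] at hqp hpal
          rw [window_eq_iff]
          intro p hp
          rw [hqp p hp, hpal p (by omega)]
          congr 1; omega
      · rintro (rfl | ⟨hq, hqp⟩)
        · refine ⟨infix_window_iff.2 ⟨i + l, by omega, by simp; omega, by simp⟩, hpal⟩
        · refine ⟨?_, hqp⟩
          rw [infix_window_iff] at hq ⊢
          obtain ⟨s, hs1, hs2, hs3⟩ := hq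
          exact ⟨s, hs1, by omega, hs3⟩
    rw [hset, Set.ncard_insert_of_notMem hnot (finite_palindromic_infixes _), ih]

theorem isRich_iff_palindromicReturns {u : ℕ → A} : IsRich u ↔ PalindromicReturns u := by
  refine ⟨IsRich.palindromicReturns, fun h w hw => ?_⟩
  obtain ⟨i, hi⟩ := mem_language_iff.1 hw
  have := h.ncard_palindromic_infixes i w.length
  rwa [← hi] at this

/-- If returns at every level start and end with mirror images of the same factor, then they are
palindromes. -/
theorem palindromicReturns_of_ends {u : ℕ → A}
    (h : ∀ n i e, IsReturn u n i (e + 1) →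
      window u (i + e) (n + 1) = (window u i (n + 1)).reverse) : PalindromicReturns u := by
  intro n i d hr
  -- The mirrored ends grow inwards one letter at a time; at `q = d` each covers the whole return.
  have key : ∀ q ≤ d, window u (i + (d - q)) (n + q) = (window u i (n + q)).reverse := by
    intro q
    induction q with
    | zero =>
      intro _
      obtain ⟨e, rfl⟩ : ∃ e, d = e + 1 := ⟨d - 1, by have := hr.pos; omega⟩
      have := h n i e hr
      rw [window_eq_reverse_iff] at this ⊢
      intro p hp
      have := this (p + 1) (by omega)
      convert this using 2 <;> omega
    | succ q ih =>
      intro hq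
      have ih := ih (by omega)
      -- The grown ends again bound a return: a mirror occurrence in between would contain one of
      -- the original window.
      have := h (n + q) i (d - (q + 1)) ⟨by omega, ?_, ?_⟩
      · exact this
      · right
        rw [← ih]; congr 2; omega
      · intro t ht0 ht hmir
        rcases hmir with hm | hm
        · refine hr.first t ht0 (by omega) (Or.inl ?_)
          rw [window_eq_iff] at hm ⊢
          exact fun p hp => hm p (by omega)
        · refine hr.first (t + q) (by omega) (by omega) (Or.inr ?_)
          rw [window_eq_reverse_iff] at hm ⊢
          intro p hp
          convert hm (p + q) (by omega) using 2 <;> omega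
  have := key d le_rfl
  rw [Nat.sub_self, add_zero, add_comm n d] at this
  exact List.Palindrome.of_reverse_eq this.symm

/-! ### Counting up to reversal; the Rauzy graph modulo reversal -/

section
open scoped Classical

/-- Orbits have size 2 or are fixed points, and a fixed point is counted once in each summand. -/
theorem two_mul_card_image_involutive {α : Type*} [DecidableEq α] (X : Finset α) (σ : α → α)
    (hσ : Function.Involutive σ) (hX : ∀ x ∈ X, σ x ∈ X) :
    2 * (X.image fun x => s(x, σ x)).card = X.card + (X.filter fun x => σ x = x).card := by
  rw [Finset.card_eq_sum_card_image (fun x => s(x, σ x)) X,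
    Finset.card_eq_sum_card_fiberwise (s := X.filter fun x => σ x = x)
      (t := X.image fun x => s(x, σ x)) (f := fun x => s(x, σ x))
      (fun x hx => Finset.mem_image_of_mem _ (Finset.mem_filter.1 hx).1),
    ← Finset.sum_add_distrib, Finset.sum_const_nat (m := 2), mul_comm]
  intro b hb
  obtain ⟨x, hx, rfl⟩ := Finset.mem_image.1 hb
  have h1 : X.filter (fun a => s(a, σ a) = s(x, σ x)) = {x, σ x} := by
    ext a
    simp only [Finset.mem_filter, Sym2.eq_iff, Finset.mem_insert, Finset.mem_singleton]
    constructor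
    · rintro ⟨-, h | h⟩
      · exact Or.inl h.1
      · exact Or.inr h.1
    · rintro (rfl | rfl)
      · exact ⟨hx, by simp⟩
      · exact ⟨hX _ hx, by simp [hσ x]⟩
  rw [Finset.filter_filter]
  by_cases hfix : σ x = x
  · have h2 : X.filter (fun a => σ a = a ∧ s(a, σ a) = s(x, σ x)) = {x} := by
      ext a
      simp only [Finset.mem_filter, Sym2.eq_iff, Finset.mem_singleton]
      constructor
      · rintro ⟨-, -, h | h⟩
        · exact h.1
        · exact h.1.trans hfix
      · rintro rfl
        exact ⟨hx, hfix, by simp⟩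
    rw [h1, h2, hfix]
    simp
  · have h2 : X.filter (fun a => σ a = a ∧ s(a, σ a) = s(x, σ x)) = ∅ := by
      refine Finset.filter_eq_empty_iff.2 ?_
      rintro a - ⟨ha, h⟩
      rw [ha, Sym2.eq_iff] at h
      rcases h with h | h
      · exact hfix (h.2.symm.trans h.1)
      · exact hfix (h.1.symm.trans h.2)
    rw [h1, h2, Finset.card_pair (Ne.symm hfix)]
    simp

/-- Each fibre contains some `x` and `σ x`. Only an inequality holds, because different edge classes
may have the same endpoints. -/
theorem two_mul_card_image_le {α β : Type*} [DecidableEq α] [DecidableEq β] (X : Finset α)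
    (σ : α → α) (g : α → β)
    (hX : ∀ x ∈ X, σ x ∈ X) (hfix : ∀ x ∈ X, σ x ≠ x) (hg : ∀ x ∈ X, g (σ x) = g x) :
    2 * (X.image g).card ≤ X.card := by
  refine Finset.mul_card_image_le_card X 2 ?_
  intro b hb
  obtain ⟨x, hx, rfl⟩ := Finset.mem_image.1 hb
  rw [← Finset.card_pair (hfix x hx)]
  refine Finset.card_le_card ?_
  intro y hy
  rcases Finset.mem_insert.1 hy with rfl | hy
  · exact Finset.mem_filter.2 ⟨hX _ hx, hg _ hx⟩
  · rw [Finset.mem_singleton.1 hy]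
    exact Finset.mem_filter.2 ⟨hx, rfl⟩

/-- A connected graph has at most one vertex more than it has edges. -/
theorem ncard_range_le_card_add_one {ι α : Type*} [Nonempty ι] (c : ι → α)
    (hc : (Set.range c).Finite) (S : Finset (Sym2 α))
    (h : ∀ a b, Relation.EqvGen (fun a b => c a = c b ∨ s(c a, c b) ∈ S) a b) :
    (Set.range c).ncard ≤ S.card + 1 := by
  have := hc.to_subtype
  let G : SimpleGraph (Set.range c) :=
    SimpleGraph.fromEdgeSet {e | e.map Subtype.val ∈ S}
  have hreach : ∀ a b, Relation.EqvGen (fun a b => c a = c b ∨ s(c a, c b) ∈ S) a b →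
      G.Reachable ⟨c a, a, rfl⟩ ⟨c b, b, rfl⟩ := by
    intro a b hab
    induction hab with
    | rel a b hab =>
      by_cases heq : c a = c b
      · simp only [heq]; exact SimpleGraph.Reachable.refl _
      · refine SimpleGraph.Adj.reachable ?_
        rw [SimpleGraph.fromEdgeSet_adj]
        exact ⟨by simpa using hab.resolve_left heq, fun h => heq (congrArg Subtype.val h)⟩
    | refl a => exact SimpleGraph.Reachable.refl _
    | symm a b _ ih => exact ih.symm
    | trans a b d _ _ ih1 ih2 => exact ih1.trans ih2
  have hconn : G.Connected := by
    have : Nonempty (Set.range c) := (Set.range_nonempty c).to_subtype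
    refine ⟨?_⟩
    rintro ⟨_, a, rfl⟩ ⟨_, b, rfl⟩
    exact hreach a b (h a b)
  have h1 := hconn.card_vert_le_card_edgeSet_add_one
  rw [Nat.card_coe_set_eq, Nat.card_coe_set_eq] at h1
  refine h1.trans (Nat.add_le_add_right ?_ 1)
  rw [← Set.ncard_coe_finset]
  refine Set.ncard_le_ncard_of_injOn (Sym2.map Subtype.val) ?_
    (Sym2.map.injective Subtype.val_injective).injOn
  intro e he
  rw [SimpleGraph.edgeSet_fromEdgeSet] at he
  exact he.1

/-- The pair consisting of a word and its reversal, a name for its class up to reversal. -/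
def mirrorClass (w : List A) : Sym2 (List A) := s(w, w.reverse)

theorem mirrorClass_eq_iff {v w : List A} : mirrorClass v = mirrorClass w ↔ Mirror v w := by
  rw [mirrorClass, mirrorClass, Sym2.eq_iff, Mirror]
  constructor
  · rintro (h | h)
    · exact Or.inl h.1
    · exact Or.inr h.1
  · rintro (rfl | rfl) <;> simp

theorem mirrorClass_reverse (w : List A) : mirrorClass w.reverse = mirrorClass w :=
  mirrorClass_eq_iff.2 (Or.inr rfl)

/-- Palindromic edges are loops modulo reversal, so they do not matter for connectedness. -/
theorem mirror_window_succ_of_palindrome {u : ℕ → A} {i n : ℕ}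
    (h : (window u i (n + 1)).reverse = window u i (n + 1)) :
    window u (i + 1) n = (window u i n).reverse := by
  rw [eq_comm, window_eq_reverse_iff] at h
  rw [window_eq_reverse_iff]
  intro p hp
  convert h (p + 1) (by omega) using 2 <;> omega

theorem PropertyC.factorComplexity_succ [Fintype A] {u : ℕ → A} (hC : PropertyC u) (n : ℕ) :
    factorComplexity u (n + 1) + 1 = factorComplexity u n + Fintype.card A := by
  have h1 := hC n
  have h2 := hC (n + 1)
  push_cast at h2
  have : ((Fintype.card A : ℤ) - 1) * (n + 1) = ((Fintype.card A : ℤ) - 1) * n +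
    ((Fintype.card A : ℤ) - 1) := by ring
  omega

variable [Finite A]

/-- The finite set of factors of length `n`. -/
noncomputable def factors (u : ℕ → A) (n : ℕ) : Finset (List A) :=
  (finite_language_length u n).toFinset

/-- The finite set of palindromic factors of length `n`. -/
noncomputable def palFactors (u : ℕ → A) (n : ℕ) : Finset (List A) :=
  (factors u n).filter fun w => w.reverse = w

/-- The finite set of factors of length `n` that are not palindromes. -/
noncomputable def nonpalFactors (u : ℕ → A) (n : ℕ) : Finset (List A) :=
  (factors u n).filter fun w => w.reverse ≠ w

theorem mem_factors {u : ℕ → A} {n : ℕ} {w : List A} :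
    w ∈ factors u n ↔ w ∈ language u ∧ w.length = n := by
  simp [factors]

theorem mem_factors_iff_window {u : ℕ → A} {n : ℕ} {w : List A} :
    w ∈ factors u n ↔ ∃ i, w = window u i n := by
  rw [mem_factors]
  constructor
  · rintro ⟨h, rfl⟩
    exact h
  · rintro ⟨i, rfl⟩
    exact ⟨window_mem_language u i n, by simp⟩

theorem card_factors (u : ℕ → A) (n : ℕ) : (factors u n).card = factorComplexity u n :=
  (Set.ncard_eq_toFinset_card _ _).symm

theorem card_palFactors (u : ℕ → A) (n : ℕ) : (palFactors u n).card = palComplexity u n := by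
  rw [← Set.ncard_coe_finset, palComplexity]
  congr 1
  ext w
  simp [palFactors, mem_factors, List.Palindrome.iff_reverse_eq, and_assoc]

theorem card_nonpalFactors (u : ℕ → A) (n : ℕ) :
    palComplexity u n + (nonpalFactors u n).card = factorComplexity u n := by
  rw [← card_palFactors, ← card_factors]
  exact Finset.card_filter_add_card_filter_not _

theorem reverse_mem_factors {u : ℕ → A} (hrev : ClosedUnderReversal u) {n : ℕ} {w : List A}
    (hw : w ∈ factors u n) : w.reverse ∈ factors u n := by
  rw [mem_factors] at hw ⊢
  exact ⟨hrev _ hw.1, by simpa using hw.2⟩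

theorem reverse_mem_nonpalFactors {u : ℕ → A} (hrev : ClosedUnderReversal u) {n : ℕ} {w : List A}
    (hw : w ∈ nonpalFactors u n) : w.reverse ∈ nonpalFactors u n := by
  rw [nonpalFactors, Finset.mem_filter] at hw ⊢
  exact ⟨reverse_mem_factors hrev hw.1, by simpa using hw.2.symm⟩

theorem two_mul_card_mirrorClass_factors {u : ℕ → A} (hrev : ClosedUnderReversal u) (n : ℕ) :
    2 * ((factors u n).image mirrorClass).card = factorComplexity u n + palComplexity u n := by
  rw [← card_factors, ← card_palFactors]
  exact two_mul_card_image_involutive (factors u n) List.reverse List.reverse_involutive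
    fun _ => reverse_mem_factors hrev

theorem two_mul_card_mirrorClass_nonpalFactors {u : ℕ → A} (hrev : ClosedUnderReversal u) (n : ℕ) :
    2 * ((nonpalFactors u n).image mirrorClass).card = (nonpalFactors u n).card := by
  have := two_mul_card_image_involutive (nonpalFactors u n) List.reverse List.reverse_involutive
    fun _ => reverse_mem_nonpalFactors hrev
  rw [Finset.filter_eq_empty_iff.2, Finset.card_empty, add_zero] at this
  · exact this
  · intro w hw
    exact (Finset.mem_filter.1 hw).2

theorem coe_image_mirrorClass_factors (u : ℕ → A) (n : ℕ) :
    (((factors u n).image mirrorClass : Finset _) : Set (Sym2 (List A))) =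
      Set.range fun t => mirrorClass (window u t n) := by
  ext c
  simp only [Finset.coe_image, Set.mem_image, Finset.mem_coe, mem_factors_iff_window, Set.mem_range]
  constructor
  · rintro ⟨_, ⟨i, rfl⟩, rfl⟩
    exact ⟨i, rfl⟩
  · rintro ⟨i, rfl⟩
    exact ⟨_, ⟨i, rfl⟩, rfl⟩

/-- If the Rauzy graph of order `n` modulo reversal is connected by the edges in `X`, then `X` is
large. -/
theorem factorComplexity_add_palComplexity_le {u : ℕ → A} (hrev : ClosedUnderReversal u) {n : ℕ}
    (X : Finset (List A)) (hXsub : X ⊆ nonpalFactors u (n + 1))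
    (hXrev : ∀ w ∈ X, w.reverse ∈ X)
    (h : ∀ t, Relation.EqvGen (fun a b => Mirror (window u a n) (window u b n) ∨
      (b = a + 1 ∧ window u a (n + 1) ∈ X)) t (t + 1)) :
    factorComplexity u n + palComplexity u n ≤ X.card + 2 := by
  let g : List A → Sym2 (Sym2 (List A)) := fun f => s(mirrorClass f.dropLast, mirrorClass f.tail)
  have hS : 2 * (X.image g).card ≤ X.card := by
    refine two_mul_card_image_le X List.reverse g hXrev
      (fun w hw => (Finset.mem_filter.1 (hXsub hw)).2) fun w _ => ?_
    simp only [g, List.dropLast_reverse, List.tail_reverse, mirrorClass_reverse]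
    exact Sym2.eq_swap
  have hfin := coe_image_mirrorClass_factors u n
  have hV := ncard_range_le_card_add_one (fun t => mirrorClass (window u t n))
    (hfin ▸ Finset.finite_toSet _) (X.image g) ?_
  · rw [← hfin, Set.ncard_coe_finset] at hV
    have := two_mul_card_mirrorClass_factors hrev n
    omega
  · have hstep : ∀ t, Relation.EqvGen (fun a b =>
        mirrorClass (window u a n) = mirrorClass (window u b n) ∨
        s(mirrorClass (window u a n), mirrorClass (window u b n)) ∈ X.image g) t (t + 1) := by
      intro t
      refine (h t).mono ?_
      rintro a b (hm | ⟨rfl, hm⟩)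
      · exact Or.inl (mirrorClass_eq_iff.2 hm)
      · refine Or.inr (Finset.mem_image.2 ⟨_, hm, ?_⟩)
        simp only [g]
        congr 3
        · rw [window_succ_right]; simp
        · rw [window_succ_left]; simp
    have hzero : ∀ t, Relation.EqvGen (fun a b =>
        mirrorClass (window u a n) = mirrorClass (window u b n) ∨
        s(mirrorClass (window u a n), mirrorClass (window u b n)) ∈ X.image g) 0 t := by
      intro t
      induction t with
      | zero => exact Relation.EqvGen.refl _
      | succ t ih => exact ih.trans _ _ _ (hstep t)
    exact fun a b => ((hzero a).symm _ _).trans _ _ _ (hzero b)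

end

/-! ### Property P and palindromic returns -/

section
open scoped Classical

/-- Reading `u` from left to right, each new edge of the Rauzy graph modulo reversal that is not a
palindrome leads to a new vertex. -/
theorem PalindromicReturns.mirror_edge_of_mirror_vertex {u : ℕ → A} (h : PalindromicReturns u)
    {n m t : ℕ} (hpal : (window u m (n + 1)).reverse ≠ window u m (n + 1)) (ht : t ≤ m)
    (hm : Mirror (window u t n) (window u (m + 1) n)) :
    ∃ t < m, Mirror (window u t (n + 1)) (window u m (n + 1)) := by
  -- The least `d` gives a return ending at `m + 1`. As a palindrome, it starts with the reversal of
  -- the edge at `m`; `d = 1` would make that edge a palindrome.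
  have hex : ∃ d, 0 < d ∧ d ≤ m + 1 ∧ Mirror (window u (m + 1 - d) n) (window u (m + 1) n) :=
    ⟨m + 1 - t, by omega, by omega, by rwa [show m + 1 - (m + 1 - t) = t by omega]⟩
  obtain ⟨hd0, hdm, hd⟩ := Nat.find_spec hex
  have hmin := fun l hl => Nat.find_min hex (m := l) hl
  generalize Nat.find hex = d at *
  have hr := h n (m + 1 - d) d ⟨hd0, ?_, ?_⟩
  · rw [palindrome_window_iff] at hr
    have hmir : window u (m + 1 - d) (n + 1) = (window u m (n + 1)).reverse := by
      rw [window_eq_reverse_iff]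
      intro p hp
      rw [hr p (by omega)]
      congr 1; omega
    refine ⟨m + 1 - d, ?_, Or.inr hmir⟩
    by_contra hlt
    obtain rfl : d = 1 := by omega
    exact hpal hmir.symm
  · rw [show m + 1 - d + d = m + 1 by omega]
    exact hd.symm
  · intro s hs0 hsd hmir
    refine hmin (d - s) (by omega) ⟨by omega, by omega, ?_⟩
    rw [show m + 1 - (d - s) = m + 1 - d + s by omega]
    exact hmir.trans hd

variable [Fintype A]

/-- Otherwise the rest of the return is a detour around its first edge `f`. The graph stays
connected without `f`, although P leaves no edge to spare. -/
theorem PropertyP.window_eq_reverse_of_isReturn {u : ℕ → A} (hrev : ClosedUnderReversal u)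
    (hC : PropertyC u) (hP : PropertyP u) (n i e : ℕ) (hr : IsReturn u n i (e + 1)) :
    window u (i + e) (n + 1) = (window u i (n + 1)).reverse := by
  by_contra hne
  set f := window u i (n + 1) with hf
  have hfpal : f.reverse ≠ f := by
    intro hpal
    have h1 := mirror_window_succ_of_palindrome hpal
    rcases Nat.eq_zero_or_pos e with rfl | he
    · exact hne hpal.symm
    · exact hr.first 1 one_pos (by omega) (Or.inr h1)
  have hfmem : f ∈ nonpalFactors u (n + 1) :=
    Finset.mem_filter.2 ⟨mem_factors_iff_window.2 ⟨i, rfl⟩, hfpal⟩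
  let X := (nonpalFactors u (n + 1)).filter fun w => ¬ Mirror w f
  have hXcard : X.card + 2 = (nonpalFactors u (n + 1)).card := by
    rw [← Finset.card_filter_add_card_filter_not (s := nonpalFactors u (n + 1))
      (fun w => Mirror w f), add_comm, ← Finset.card_pair (Ne.symm hfpal)]
    congr 2
    ext w
    rw [Finset.mem_insert, Finset.mem_singleton, Finset.mem_filter]
    constructor
    · rintro (rfl | rfl)
      · exact ⟨hfmem, Or.inl rfl⟩
      · exact ⟨reverse_mem_nonpalFactors hrev hfmem, Or.inr rfl⟩
    · exact fun h => h.2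
  have hXrev : ∀ w ∈ X, w.reverse ∈ X := by
    intro w hw
    rw [Finset.mem_filter] at hw ⊢
    exact ⟨reverse_mem_nonpalFactors hrev hw.1, fun h => hw.2 (Mirror.trans (Or.inr (by simp)) h)⟩
  have hbound := factorComplexity_add_palComplexity_le hrev X (Finset.filter_subset _ _) hXrev
    (n := n) ?_
  · have h1 := card_nonpalFactors u (n + 1)
    have h2 := hC.factorComplexity_succ n
    have h3 := hP n
    omega
  set r : ℕ → ℕ → Prop := fun a b => Mirror (window u a n) (window u b n) ∨
      (b = a + 1 ∧ window u a (n + 1) ∈ X) with hrdef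
  have hbase : ∀ t, ¬ Mirror (window u t (n + 1)) f → Relation.EqvGen r t (t + 1) := by
    intro t ht
    refine Relation.EqvGen.rel _ _ ?_
    by_cases hpal : (window u t (n + 1)).reverse = window u t (n + 1)
    · exact Or.inl (Mirror.symm (Or.inr (mirror_window_succ_of_palindrome hpal)))
    · exact Or.inr ⟨rfl, Finset.mem_filter.2
        ⟨Finset.mem_filter.2 ⟨mem_factors_iff_window.2 ⟨t, rfl⟩, hpal⟩, ht⟩⟩
  -- Crossing `f` in either direction would put a mirror occurrence strictly inside the return,
  -- except for a reversed crossing at the last step, which `hne` excludes.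
  have hpath : ∀ s ≤ e, Relation.EqvGen r (i + 1) (i + 1 + s) := by
    intro s
    induction s with
    | zero => exact fun _ => Relation.EqvGen.refl _
    | succ s ih =>
      intro hs
      refine (ih (by omega)).trans _ _ _ (hbase _ ?_)
      rintro (hm | hm)
      · refine hr.first (s + 1) (by omega) (by omega) (Or.inl ?_)
        rw [window_eq_iff] at hm ⊢
        intro p hp
        convert hm p (by omega) using 2; omega
      · by_cases hse : s + 1 = e
        · refine hne ?_
          rw [← hm, ← hse]; congr 1; omega
        · refine hr.first (s + 2) (by omega) (by omega) (Or.inr ?_)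
          rw [window_eq_reverse_iff] at hm ⊢
          intro p hp
          convert hm (p + 1) (by omega) using 2 <;> omega
  have hi : Relation.EqvGen r i (i + 1) := by
    refine ((hpath e le_rfl).trans _ _ _ (Relation.EqvGen.rel _ _ (Or.inl ?_))).symm _ _
    have := hr.mirror
    rwa [show i + (e + 1) = i + 1 + e by omega] at this
  intro t
  by_cases ht : Mirror (window u t (n + 1)) f
  · rcases ht with hm | hm
    · have h1 : r t i := Or.inl (Or.inl (by
        rw [window_eq_iff] at hm ⊢
        exact fun p hp => hm p (by omega)))
      have h2 : r (t + 1) (i + 1) := Or.inl (Or.inl (by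
        rw [window_eq_iff] at hm ⊢
        intro p hp
        convert hm (p + 1) (by omega) using 2 <;> omega))
      exact ((Relation.EqvGen.rel _ _ h1).trans _ _ _ hi).trans _ _ _
        ((Relation.EqvGen.rel _ _ h2).symm _ _)
    · have h1 : r t (i + 1) := Or.inl (Or.inr (by
        rw [window_eq_reverse_iff] at hm ⊢
        intro p hp
        convert hm p (by omega) using 2; omega))
      have h2 : r (t + 1) i := Or.inl (Or.inr (by
        rw [window_eq_reverse_iff] at hm ⊢
        intro p hp
        convert hm (p + 1) (by omega) using 2 <;> omega))
      exact ((Relation.EqvGen.rel _ _ h1).trans _ _ _ (hi.symm _ _)).trans _ _ _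
        ((Relation.EqvGen.rel _ _ h2).symm _ _)
  · exact hbase t ht

theorem PropertyP.palindromicReturns {u : ℕ → A} (hrev : ClosedUnderReversal u)
    (hC : PropertyC u) (hP : PropertyP u) : PalindromicReturns u :=
  palindromicReturns_of_ends (hP.window_eq_reverse_of_isReturn hrev hC)

theorem PalindromicReturns.factorComplexity_succ_add_two_le {u : ℕ → A}
    (hrev : ClosedUnderReversal u) (h : PalindromicReturns u) (n : ℕ) :
    factorComplexity u (n + 1) + 2 ≤
      factorComplexity u n + palComplexity u n + palComplexity u (n + 1) := by
  -- The part of the graph seen along the first `m` steps: vertices at positions `0` to `m`, and the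
  -- edges traversed between them.
  let V : ℕ → Finset (Sym2 (List A)) := fun m =>
    (Finset.range (m + 1)).image fun t => mirrorClass (window u t n)
  let E : ℕ → Finset (Sym2 (List A)) := fun m =>
    ((Finset.range m).filter fun t => (window u t (n + 1)).reverse ≠ window u t (n + 1)).image
      fun t => mirrorClass (window u t (n + 1))
  have key : ∀ m, (E m).card + 1 ≤ (V m).card := by
    intro m
    induction m with
    | zero => simp [E, V]
    | succ m ih =>
      have hV : V (m + 1) = insert (mirrorClass (window u (m + 1) n)) (V m) := by
        simp only [V]
        rw [Finset.range_add_one, Finset.image_insert]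
      have hVle : (V m).card ≤ (V (m + 1)).card := by
        rw [hV]; exact Finset.card_le_card (Finset.subset_insert _ _)
      by_cases hpal : (window u m (n + 1)).reverse = window u m (n + 1)
      · have hE : E (m + 1) = E m := by
          simp only [E]
          rw [Finset.range_add_one, Finset.filter_insert, if_neg (by simpa using hpal)]
        rw [hE]; omega
      have hE : E (m + 1) = insert (mirrorClass (window u m (n + 1))) (E m) := by
        simp only [E]
        rw [Finset.range_add_one, Finset.filter_insert, if_pos hpal, Finset.image_insert]
      by_cases hold : mirrorClass (window u m (n + 1)) ∈ E m
      · rw [hE, Finset.insert_eq_of_mem hold]; omega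
      · have hnew : mirrorClass (window u (m + 1) n) ∉ V m := by
          intro hmem
          obtain ⟨t, ht, hm⟩ := Finset.mem_image.1 hmem
          obtain ⟨s, hs, hms⟩ := h.mirror_edge_of_mirror_vertex hpal
            (by simpa [Nat.lt_succ_iff] using ht) (mirrorClass_eq_iff.1 hm)
          refine hold (Finset.mem_image.2 ⟨s, Finset.mem_filter.2 ⟨by simpa using hs, ?_⟩,
            mirrorClass_eq_iff.2 hms⟩)
          rcases hms with hms | hms
          · rwa [hms]
          · rw [hms]; simpa using Ne.symm hpal
        rw [hE, hV, Finset.card_insert_of_notMem hold, Finset.card_insert_of_notMem hnew]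
        omega
  have hEmono : Monotone E := fun a b hab =>
    Finset.image_subset_image (Finset.filter_subset_filter _ (Finset.range_mono hab))
  have hEex : ∃ m, (nonpalFactors u (n + 1)).image mirrorClass ⊆ E m := by
    have : ∀ c ∈ (nonpalFactors u (n + 1)).image mirrorClass, ∃ m, c ∈ E m := by
      intro c hc
      obtain ⟨w, hw, rfl⟩ := Finset.mem_image.1 hc
      obtain ⟨hw, hpal⟩ := Finset.mem_filter.1 hw
      obtain ⟨i, rfl⟩ := mem_factors_iff_window.1 hw
      exact ⟨i + 1, Finset.mem_image.2 ⟨i, Finset.mem_filter.2 ⟨by simp, hpal⟩, rfl⟩⟩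
    choose! m hm using this
    exact ⟨((nonpalFactors u (n + 1)).image mirrorClass).sup m, fun c hc =>
      hEmono (Finset.le_sup hc) (hm c hc)⟩
  obtain ⟨m, hm⟩ := hEex
  have h1 := Finset.card_le_card hm
  have h2 : (V m).card ≤ ((factors u n).image mirrorClass).card := by
    refine Finset.card_le_card ?_
    intro c hc
    obtain ⟨t, -, rfl⟩ := Finset.mem_image.1 hc
    exact Finset.mem_image_of_mem _ (mem_factors_iff_window.2 ⟨t, rfl⟩)
  have h3 := two_mul_card_mirrorClass_factors hrev n
  have h4 := two_mul_card_mirrorClass_nonpalFactors hrev (n + 1)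
  have h5 := card_nonpalFactors u (n + 1)
  have h6 := key m
  omega

/-- Connectedness bounds P(n) + P(n+1) from above, palindromic returns from below. -/
theorem PalindromicReturns.propertyP {u : ℕ → A} (hrev : ClosedUnderReversal u)
    (hC : PropertyC u) (h : PalindromicReturns u) : PropertyP u := by
  intro n
  have h1 := h.factorComplexity_succ_add_two_le hrev n
  have h2 := factorComplexity_add_palComplexity_le hrev (n := n) (nonpalFactors u (n + 1))
    subset_rfl (fun _ => reverse_mem_nonpalFactors hrev) ?_
  · have h3 := card_nonpalFactors u (n + 1)
    have h4 := hC.factorComplexity_succ n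
    omega
  · intro t
    refine Relation.EqvGen.rel _ _ ?_
    by_cases hpal : (window u t (n + 1)).reverse = window u t (n + 1)
    · exact Or.inl (Mirror.symm (Or.inr (mirror_window_succ_of_palindrome hpal)))
    · exact Or.inr ⟨rfl, Finset.mem_filter.2 ⟨mem_factors_iff_window.2 ⟨t, rfl⟩, hpal⟩⟩

end

/-! ### Extensions of factors and consecutive occurrences -/

theorem exists_append_singleton_mem {u : ℕ → A} {w : List A} (hw : w ∈ language u) :
    ∃ b, w ++ [b] ∈ language u := by
  obtain ⟨i, hi⟩ := mem_language_iff.1 hw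
  refine ⟨u (i + w.length), ?_⟩
  nth_rewrite 1 [hi]
  rw [← window_succ_right]
  exact window_mem_language _ _ _

theorem append_singleton_mem_iff {u : ℕ → A} (hrev : ClosedUnderReversal u) {w : List A} {b : A} :
    w ++ [b] ∈ language u ↔ b :: w.reverse ∈ language u :=
  ⟨fun h => by simpa using hrev _ h, fun h => by simpa using hrev _ h⟩

/-- An occurrence at position 0 has no letter before it, so the right extension of the reversal is
used. -/
theorem exists_cons_mem {u : ℕ → A} (hrev : ClosedUnderReversal u) {w : List A}
    (hw : w ∈ language u) : ∃ a, a :: w ∈ language u := by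
  obtain ⟨a, ha⟩ := exists_append_singleton_mem (hrev w hw)
  exact ⟨a, by simpa using hrev _ ha⟩

theorem Rext_eq_Lext_reverse {u : ℕ → A} (hrev : ClosedUnderReversal u) (w : List A) :
    Rext u w = Lext u w.reverse :=
  Set.ext fun _ => append_singleton_mem_iff hrev

theorem cons_append_singleton_injective (w : List A) :
    Function.Injective fun p : A × A => p.1 :: (w ++ [p.2]) := by
  rintro ⟨a, b⟩ ⟨a', b'⟩ h
  simpa using h

theorem exists_eq_cons_append_singleton {v : List A} {n : ℕ} (h : v.length = n + 2) :
    ∃ (a : A) (w : List A) (b : A), w.length = n ∧ v = a :: (w ++ [b]) := by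
  obtain ⟨a, v, rfl⟩ := List.exists_cons_of_length_eq_add_one h
  rcases List.eq_nil_or_concat v with rfl | ⟨w, b, rfl⟩
  · simp at h
  · exact ⟨a, w, b, by simpa using h, by simp⟩

/-- `#Pext(w) - 1` for a palindrome `w`, and `0` for other words. -/
noncomputable def palOrder (u : ℕ → A) (w : List A) : ℤ :=
  open scoped Classical in if w.reverse = w then (Pext u w).ncard - 1 else 0

theorem bilateralOrder_conditions_iff {u : ℕ → A} (w : List A) :
    ((¬ w.Palindrome → bilateralOrder u w = 0) ∧
      (w.Palindrome → bilateralOrder u w = ((Pext u w).ncard : ℤ) - 1)) ↔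
    bilateralOrder u w = palOrder u w := by
  rw [List.Palindrome.iff_reverse_eq, palOrder]
  by_cases h : w.reverse = w <;> simp [h]

/-- If consecutive elements of a set of natural numbers are related, then all its elements are. -/
theorem eqvGen_of_consecutive {p : ℕ → Prop} (r : {s // p s} → {s // p s} → Prop)
    (h : ∀ (s d : ℕ) (hs : p s) (hd : p (s + d)), 0 < d → (∀ t, 0 < t → t < d → ¬ p (s + t)) →
      r ⟨s, hs⟩ ⟨s + d, hd⟩) (a b : {s // p s}) : Relation.EqvGen r a b := by
  classical
  have key : ∀ (k s : ℕ) (hs : p s) (hk : p (s + k)), Relation.EqvGen r ⟨s, hs⟩ ⟨s + k, hk⟩ := by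
    intro k
    induction k using Nat.strong_induction_on with
    | _ k ih =>
      intro s hs hk
      rcases Nat.eq_zero_or_pos k with rfl | hk0
      · exact Relation.EqvGen.refl _
      have hex : ∃ d, 0 < d ∧ p (s + d) := ⟨k, hk0, hk⟩
      obtain ⟨hd0, hd⟩ := Nat.find_spec hex
      have hmin := fun l hl => Nat.find_min hex (m := l) hl
      have hle : Nat.find hex ≤ k := Nat.find_min' hex ⟨hk0, hk⟩
      generalize Nat.find hex = d at *
      obtain ⟨e, rfl⟩ := Nat.exists_eq_add_of_le hle
      have h1 := h s d hs hd hd0 fun t ht0 ht hpt => hmin t ht ⟨ht0, hpt⟩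
      have h2 := ih e (by omega) (s + d) hd (by rwa [add_assoc])
      refine (Relation.EqvGen.rel _ _ h1).trans _ _ _ ?_
      convert h2 using 2
      omega
  obtain ⟨a, ha⟩ := a
  obtain ⟨b, hb⟩ := b
  rcases le_total a b with hab | hab
  · obtain ⟨k, rfl⟩ := Nat.exists_eq_add_of_le hab
    exact key k a ha hb
  · obtain ⟨k, rfl⟩ := Nat.exists_eq_add_of_le hab
    exact (key k b hb ha).symm _ _

theorem PalindromicReturns.letter_eq {u : ℕ → A} (h : PalindromicReturns u) {n s d : ℕ}
    (hr : IsReturn u n (s + 1) d) : u (s + 1 + n) = u (s + d) := by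
  have h1 := h _ _ _ hr
  have h2 := hr.pos
  rw [palindrome_window_iff] at h1
  rw [h1 n (by omega)]
  congr 1; omega

theorem PalindromicReturns.window_eq_reverse {u : ℕ → A} (h : PalindromicReturns u) {n i d : ℕ}
    (hr : IsReturn u n i d) : window u (i + d) n = (window u i n).reverse := by
  have h1 := h _ _ _ hr
  have h2 := hr.pos
  rw [palindrome_window_iff] at h1
  rw [window_eq_reverse_iff]
  intro p hp
  rw [add_assoc, h1 (d + p) (by omega)]
  congr 1; omega

/-- Occurrences are indexed by the position `s` of the letter before them, so that `u s` is the left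
neighbour. -/
theorem isReturn_of_consecutive {u : ℕ → A} {w : List A} {s d : ℕ}
    (hs : Mirror (window u (s + 1) w.length) w) (hd : Mirror (window u (s + d + 1) w.length) w)
    (hd0 : 0 < d) (hmin : ∀ t, 0 < t → t < d → ¬ Mirror (window u (s + t + 1) w.length) w) :
    IsReturn u w.length (s + 1) d := by
  refine ⟨hd0, ?_, fun t ht0 ht hm => hmin t ht0 ht ?_⟩
  · rw [show s + 1 + d = s + d + 1 by omega]
    exact hd.trans hs.symm
  · rw [show s + t + 1 = s + 1 + t by omega]
    exact hm.trans hs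

theorem cons_window_mem (u : ℕ → A) (s n : ℕ) : u s :: window u (s + 1) n ∈ language u := by
  rw [← window_succ_left]
  exact window_mem_language _ _ _

theorem cons_window_append_mem (u : ℕ → A) (s n : ℕ) :
    u s :: (window u (s + 1) n ++ [u (s + 1 + n)]) ∈ language u := by
  rw [← window_succ_right, ← window_succ_left]
  exact window_mem_language _ _ _

theorem exists_window_of_cons_mem {u : ℕ → A} {w : List A} {a : A} (h : a :: w ∈ language u) :
    ∃ s, u s = a ∧ window u (s + 1) w.length = w := by
  obtain ⟨s, hs⟩ := mem_language_iff.1 h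
  rw [List.length_cons, window_succ_left, List.cons_eq_cons] at hs
  exact ⟨s, hs.1.symm, hs.2.symm⟩

/-! ### Bilateral orders: extension graphs and sums over a length -/

section
open scoped Classical

variable [Fintype A]

/-- The pairs of letters `(a, b)` such that `awb` is a factor. -/
noncomputable def bextPairs (u : ℕ → A) (w : List A) : Finset (A × A) :=
  Finset.univ.filter fun p => p.1 :: (w ++ [p.2]) ∈ language u

theorem mem_bextPairs {u : ℕ → A} {w : List A} {p : A × A} :
    p ∈ bextPairs u w ↔ p.1 :: (w ++ [p.2]) ∈ language u := by
  simp [bextPairs]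

theorem ncard_Bext (u : ℕ → A) (w : List A) : (Bext u w).ncard = (bextPairs u w).card := by
  rw [← Set.ncard_coe_finset, ← Set.ncard_image_of_injective _ (cons_append_singleton_injective w)]
  congr 1
  ext v
  simp only [Bext, Set.mem_ofPred_eq, Set.mem_image, Finset.mem_coe, mem_bextPairs, Prod.exists]
  constructor
  · rintro ⟨hv, a, b, rfl⟩
    exact ⟨a, b, hv, rfl⟩
  · rintro ⟨a, b, hv, rfl⟩
    exact ⟨hv, a, b, rfl⟩

theorem ncard_Pext (u : ℕ → A) (w : List A) :
    (Pext u w).ncard = ((bextPairs u w).filter fun p => p.1 = p.2).card := by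
  rw [← Set.ncard_coe_finset, ← Set.ncard_image_of_injective _ (cons_append_singleton_injective w)]
  congr 1
  ext v
  simp only [Pext, Set.mem_ofPred_eq, Set.mem_image, Finset.mem_coe, Finset.mem_filter,
    mem_bextPairs, Prod.exists]
  constructor
  · rintro ⟨hv, a, rfl⟩
    exact ⟨a, a, ⟨hv, rfl⟩, rfl⟩
  · rintro ⟨a, b, ⟨hv, hab⟩, rfl⟩
    obtain rfl : a = b := hab
    exact ⟨hv, a, rfl⟩

/-- Join letters `a ≠ b` when `awb` is a factor. By `letter_eq`, the letter after one occurrence of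
`w` is the letter before the next, so `u` walks through all of `Lext u w` and the graph is
connected. Swapping `a` and `b` pairs up the non-palindromic extensions. -/
theorem PalindromicReturns.two_mul_ncard_Lext_add_ncard_Pext_le {u : ℕ → A}
    (hrev : ClosedUnderReversal u) (h : PalindromicReturns u) {w : List A} (hw : w ∈ language u)
    (hpal : w.reverse = w) :
    2 * (Lext u w).ncard + (Pext u w).ncard ≤ (Bext u w).ncard + 2 := by
  have hmir : ∀ {v}, Mirror v w → v = w := by
    rintro v (rfl | rfl)
    · rfl
    · exact hpal
  let T := {s // Mirror (window u (s + 1) w.length) w}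
  let c : T → A := fun s => u s
  have hrange : Set.range c = Lext u w := by
    ext a
    constructor
    · rintro ⟨⟨s, hs⟩, rfl⟩
      have := cons_window_mem u s w.length
      rwa [hmir hs] at this
    · intro ha
      obtain ⟨s, rfl, hs⟩ := exists_window_of_cons_mem ha
      exact ⟨⟨s, Or.inl hs⟩, rfl⟩
  have hne : Nonempty T := by
    obtain ⟨a, ha⟩ := exists_cons_mem hrev hw
    obtain ⟨s, -, hs⟩ := exists_window_of_cons_mem ha
    exact ⟨⟨s, Or.inl hs⟩⟩
  let X := (bextPairs u w).filter fun p => ¬ p.1 = p.2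
  have hV := ncard_range_le_card_add_one c (Set.toFinite _) (X.image fun p => s(p.1, p.2)) ?_
  · have hS := two_mul_card_image_le X Prod.swap (fun p => s(p.1, p.2)) ?_ ?_ ?_
    · have := Finset.card_filter_add_card_filter_not (s := bextPairs u w) (fun p => p.1 = p.2)
      rw [hrange] at hV
      rw [ncard_Bext, ncard_Pext]
      simp only [X] at hV hS
      omega
    · intro p hp
      rw [Finset.mem_filter, mem_bextPairs] at hp ⊢
      refine ⟨?_, fun h => hp.2 h.symm⟩
      have := hrev _ hp.1
      simpa [hpal] using this
    · rintro ⟨a, b⟩ hp heq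
      exact (Finset.mem_filter.1 hp).2 (congrArg Prod.snd heq)
    · exact fun p _ => Sym2.eq_swap
  · refine eqvGen_of_consecutive _ fun s d hs hd hd0 hmin => ?_
    have hr := isReturn_of_consecutive hs hd hd0 hmin
    by_cases heq : u s = u (s + d)
    · exact Or.inl heq
    · refine Or.inr (Finset.mem_image.2 ⟨(u s, u (s + d)), ?_, rfl⟩)
      rw [Finset.mem_filter, mem_bextPairs]
      refine ⟨?_, heq⟩
      have := cons_window_append_mem u s w.length
      rwa [hmir hs, h.letter_eq hr] at this

/-- The graph is now bipartite on left and right extensions, with an edge for each `awb`.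
Occurrences of `w` and its reversal alternate, and a letter before the reversal is a right extension
of `w`; so `u` again walks through the whole graph. -/
theorem PalindromicReturns.ncard_Lext_add_ncard_Rext_le {u : ℕ → A}
    (hrev : ClosedUnderReversal u) (h : PalindromicReturns u) {w : List A} (hw : w ∈ language u)
    (hpal : w.reverse ≠ w) :
    (Lext u w).ncard + (Rext u w).ncard ≤ (Bext u w).ncard + 1 := by
  let T := {s // Mirror (window u (s + 1) w.length) w}
  let c : T → A ⊕ A := fun s =>
    if window u (s + 1) w.length = w then Sum.inl (u s) else Sum.inr (u s)
  have hrange : Set.range c = Sum.inl '' Lext u w ∪ Sum.inr '' Rext u w := by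
    ext a
    constructor
    · rintro ⟨⟨s, hs⟩, rfl⟩
      have := cons_window_mem u s w.length
      by_cases hsw : window u (s + 1) w.length = w
      · rw [hsw] at this
        exact Or.inl ⟨u s, this, by simp [c, hsw]⟩
      · rw [hs.resolve_left hsw] at this
        exact Or.inr ⟨u s, (append_singleton_mem_iff hrev).2 this, by simp [c, hsw]⟩
    · rintro (⟨a, ha, rfl⟩ | ⟨b, hb, rfl⟩)
      · obtain ⟨s, rfl, hs⟩ := exists_window_of_cons_mem ha
        exact ⟨⟨s, Or.inl hs⟩, by simp [c, hs]⟩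
      · obtain ⟨s, rfl, hs⟩ := exists_window_of_cons_mem ((append_singleton_mem_iff hrev).1 hb)
        rw [List.length_reverse] at hs
        exact ⟨⟨s, Or.inr hs⟩, by simp [c, hs, hpal]⟩
  have hne : Nonempty T := by
    obtain ⟨a, ha⟩ := exists_cons_mem hrev hw
    obtain ⟨s, -, hs⟩ := exists_window_of_cons_mem ha
    exact ⟨⟨s, Or.inl hs⟩⟩
  have hV := ncard_range_le_card_add_one c (Set.toFinite _)
    ((bextPairs u w).image fun p => s(Sum.inl p.1, Sum.inr p.2)) ?_
  · rw [hrange, Set.ncard_union_eq, Set.ncard_image_of_injective _ Sum.inl_injective,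
      Set.ncard_image_of_injective _ Sum.inr_injective] at hV
    · rw [ncard_Bext]
      exact hV.trans (Nat.add_le_add_right Finset.card_image_le 1)
    · rw [Set.disjoint_left]
      rintro _ ⟨a, -, rfl⟩ ⟨b, -, hb⟩
      cases hb
  · refine eqvGen_of_consecutive _ fun s d hs hd hd0 hmin => ?_
    have hr := isReturn_of_consecutive hs hd hd0 hmin
    have hword := cons_window_append_mem u s w.length
    have hnext := h.window_eq_reverse hr
    rw [h.letter_eq hr] at hword
    rw [show s + 1 + d = s + d + 1 by omega] at hnext
    refine Or.inr ?_
    by_cases hsw : window u (s + 1) w.length = w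
    · rw [hsw] at hnext hword
      refine Finset.mem_image.2 ⟨(u s, u (s + d)), mem_bextPairs.2 hword, ?_⟩
      simp [c, hsw, hnext, hpal]
    · have hsw' := hs.resolve_left hsw
      rw [hsw', List.reverse_reverse] at hnext
      rw [hsw'] at hword
      refine Finset.mem_image.2 ⟨(u (s + d), u s), mem_bextPairs.2 ?_, ?_⟩
      · simpa using hrev _ hword
      · simp [c, hsw', hnext, hpal]

theorem PalindromicReturns.palOrder_le_bilateralOrder {u : ℕ → A}
    (hrev : ClosedUnderReversal u) (h : PalindromicReturns u) {w : List A} (hw : w ∈ language u) :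
    palOrder u w ≤ bilateralOrder u w := by
  unfold palOrder bilateralOrder
  split_ifs with hpal
  · have h1 := h.two_mul_ncard_Lext_add_ncard_Pext_le hrev hw hpal
    have h2 := Rext_eq_Lext_reverse hrev w
    rw [hpal] at h2
    rw [h2]
    omega
  · have := h.ncard_Lext_add_ncard_Rext_le hrev hw hpal
    omega

theorem sum_ncard_Bext (u : ℕ → A) (n : ℕ) :
    ∑ w ∈ factors u n, (Bext u w).ncard = factorComplexity u (n + 2) := by
  rw [← card_factors, Finset.card_eq_sum_card_fiberwise (f := fun v => v.tail.dropLast)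
    (t := factors u n)]
  · refine Finset.sum_congr rfl fun w hw => ?_
    rw [← Set.ncard_coe_finset]
    congr 1
    ext v
    rw [mem_factors] at hw
    simp only [Bext, Set.mem_ofPred_eq, Finset.coe_filter, mem_factors]
    constructor
    · rintro ⟨hv, a, b, rfl⟩
      exact ⟨⟨hv, by simp [hw.2]⟩, by simp⟩
    · rintro ⟨⟨hv, hl⟩, rfl⟩
      obtain ⟨a, x, b, -, rfl⟩ := exists_eq_cons_append_singleton hl
      exact ⟨hv, a, b, by simp⟩
  · intro v hv
    simp only [Finset.mem_coe, mem_factors] at hv ⊢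
    obtain ⟨a, x, b, hx, rfl⟩ := exists_eq_cons_append_singleton hv.2
    refine ⟨mem_language_of_infix hv.1 ⟨[a], [b], by simp⟩, by simpa using hx⟩

theorem sum_ncard_Rext (u : ℕ → A) (n : ℕ) :
    ∑ w ∈ factors u n, (Rext u w).ncard = factorComplexity u (n + 1) := by
  rw [← card_factors, Finset.card_eq_sum_card_fiberwise (f := fun v => v.dropLast)
    (t := factors u n)]
  · refine Finset.sum_congr rfl fun w hw => ?_
    rw [← Set.ncard_coe_finset, ← Set.ncard_image_of_injective (f := fun b => w ++ [b]) _
      (fun a b hab => by simpa using hab)]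
    congr 1
    ext v
    rw [mem_factors] at hw
    simp only [Rext, Set.mem_image, Set.mem_ofPred_eq, Finset.coe_filter, mem_factors]
    constructor
    · rintro ⟨b, hv, rfl⟩
      exact ⟨⟨hv, by simp [hw.2]⟩, by simp⟩
    · rintro ⟨⟨hv, hl⟩, rfl⟩
      rcases List.eq_nil_or_concat v with rfl | ⟨x, b, rfl⟩
      · simp at hl
      · exact ⟨b, by simpa using hv, by simp⟩
  · intro v hv
    simp only [Finset.mem_coe, mem_factors] at hv ⊢
    exact ⟨mem_language_of_infix hv.1 (List.dropLast_prefix v).isInfix, by simp [hv.2]⟩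

theorem sum_ncard_Lext (u : ℕ → A) (n : ℕ) :
    ∑ w ∈ factors u n, (Lext u w).ncard = factorComplexity u (n + 1) := by
  rw [← card_factors, Finset.card_eq_sum_card_fiberwise (f := fun v => v.tail)
    (t := factors u n)]
  · refine Finset.sum_congr rfl fun w hw => ?_
    rw [← Set.ncard_coe_finset, ← Set.ncard_image_of_injective (f := fun a => a :: w) _
      (fun a b hab => by simpa using hab)]
    congr 1
    ext v
    rw [mem_factors] at hw
    simp only [Lext, Set.mem_image, Set.mem_ofPred_eq, Finset.coe_filter, mem_factors]
    constructor
    · rintro ⟨b, hv, rfl⟩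
      exact ⟨⟨hv, by simp [hw.2]⟩, by simp⟩
    · rintro ⟨⟨hv, hl⟩, rfl⟩
      obtain ⟨a, x, rfl⟩ := List.exists_cons_of_length_eq_add_one hl
      exact ⟨a, hv, rfl⟩
  · intro v hv
    simp only [Finset.mem_coe, mem_factors] at hv ⊢
    exact ⟨mem_language_of_infix hv.1 (List.tail_suffix v).isInfix, by simp [hv.2]⟩

/-- The sum is the second difference of C, and C is affine. -/
theorem PropertyC.sum_bilateralOrder {u : ℕ → A} (hC : PropertyC u) (n : ℕ) :
    ∑ w ∈ factors u n, bilateralOrder u w = 0 := by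
  have h1 := sum_ncard_Bext u n
  have h2 := sum_ncard_Rext u n
  have h3 := sum_ncard_Lext u n
  have h4 := card_factors u n
  have h5 := hC.factorComplexity_succ n
  have h6 := hC.factorComplexity_succ (n + 1)
  simp only [bilateralOrder, Finset.sum_add_distrib, Finset.sum_sub_distrib, ← Nat.cast_sum,
    Finset.sum_const, h1, h2, h3, h4]
  simp only [nsmul_eq_mul, mul_one]
  rw [show n + 1 + 1 = n + 2 by omega] at h6
  omega

theorem sum_ncard_Pext (u : ℕ → A) (n : ℕ) :
    ∑ w ∈ palFactors u n, (Pext u w).ncard = palComplexity u (n + 2) := by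
  rw [← card_palFactors, Finset.card_eq_sum_card_fiberwise (f := fun v => v.tail.dropLast)
    (t := palFactors u n)]
  · refine Finset.sum_congr rfl fun w hw => ?_
    rw [← Set.ncard_coe_finset]
    congr 1
    ext v
    rw [palFactors, Finset.mem_filter, mem_factors] at hw
    simp only [Pext, palFactors, Finset.filter_filter, Set.mem_ofPred_eq, Finset.coe_filter,
      mem_factors]
    constructor
    · rintro ⟨hv, a, rfl⟩
      exact ⟨⟨hv, by simp [hw.1.2]⟩, by simp [hw.2], by simp⟩
    · rintro ⟨⟨hv, hl⟩, hpal, rfl⟩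
      obtain ⟨a, x, b, -, rfl⟩ := exists_eq_cons_append_singleton hl
      obtain rfl : b = a := by simp at hpal; exact hpal.1
      exact ⟨hv, b, by simp⟩
  · intro v hv
    simp only [palFactors, Finset.mem_coe, Finset.mem_filter, mem_factors] at hv ⊢
    obtain ⟨⟨hv, hl⟩, hpal⟩ := hv
    obtain ⟨a, x, b, hx, rfl⟩ := exists_eq_cons_append_singleton hl
    refine ⟨⟨mem_language_of_infix hv ⟨[a], [b], by simp⟩, by simpa using hx⟩, ?_⟩
    simp only [List.reverse_cons, List.reverse_append, List.reverse_nil, List.nil_append,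
      List.cons_append, List.cons_eq_cons] at hpal
    simpa using List.append_inj_left' hpal.2 rfl

theorem sum_palOrder (u : ℕ → A) (n : ℕ) :
    ∑ w ∈ factors u n, palOrder u w = palComplexity u (n + 2) - palComplexity u n := by
  have h1 := sum_ncard_Pext u n
  have h2 := card_palFactors u n
  simp only [palOrder]
  rw [← Finset.sum_filter]
  change ∑ w ∈ palFactors u n, _ = _
  rw [Finset.sum_sub_distrib, ← Nat.cast_sum, h1]
  simp [h2]

/-- Both sides are 0: with one forced side, bilateral extensions correspond to extensions on the
other side, and a palindrome then has a single extension, of the form `awa`. -/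
theorem bilateralOrder_eq_palOrder_of_not_isBispecial {u : ℕ → A} (hrev : ClosedUnderReversal u)
    {w : List A} (hw : w ∈ language u) (h : ¬ IsBispecial u w) :
    bilateralOrder u w = palOrder u w := by
  have hL : (Lext u w).Nonempty := exists_cons_mem hrev hw
  have hR : (Rext u w).Nonempty := exists_append_singleton_mem hw
  have hL' := (Set.ncard_pos (Set.toFinite _)).2 hL
  have hR' := (Set.ncard_pos (Set.toFinite _)).2 hR
  have hpalOrder : ∀ a, Rext u w = {a} → palOrder u w = 0 := by
    intro a ha
    unfold palOrder
    split_ifs with hpal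
    · have hLa : Lext u w = {a} := by rw [← ha, Rext_eq_Lext_reverse hrev, hpal]
      have hP : Pext u w = {a :: (w ++ [a])} := by
        ext v
        constructor
        · rintro ⟨hv, b, rfl⟩
          have : b ∈ Lext u w := mem_language_of_infix hv ⟨[], [b], by simp⟩
          rw [hLa] at this
          rw [Set.mem_singleton_iff.1 this]
          rfl
        · rintro rfl
          refine ⟨?_, a, rfl⟩
          have ha' : a :: w ∈ language u := by
            have : a ∈ Lext u w := hLa ▸ rfl
            exact this
          obtain ⟨b, hb⟩ := exists_append_singleton_mem ha'
          have : b ∈ Rext u w := mem_language_of_infix hb ⟨[a], [], by simp⟩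
          rw [ha] at this
          rw [Set.mem_singleton_iff.1 this] at hb
          exact hb
      rw [hP]; simp
    · rfl
  by_cases hR1 : (Rext u w).ncard = 1
  · obtain ⟨b, hb⟩ := Set.ncard_eq_one.1 hR1
    have hB : Bext u w = (fun a => a :: (w ++ [b])) '' Lext u w := by
      ext v
      constructor
      · rintro ⟨hv, a, b', rfl⟩
        have : b' ∈ Rext u w := mem_language_of_infix hv ⟨[a], [], by simp⟩
        rw [hb] at this
        rw [Set.mem_singleton_iff.1 this] at hv ⊢
        exact ⟨a, mem_language_of_infix hv ⟨[], [b], by simp⟩, rfl⟩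
      · rintro ⟨a, ha, rfl⟩
        refine ⟨?_, a, b, rfl⟩
        obtain ⟨b', hb'⟩ := exists_append_singleton_mem (show a :: w ∈ language u from ha)
        have : b' ∈ Rext u w := mem_language_of_infix hb' ⟨[a], [], by simp⟩
        rw [hb] at this
        rw [Set.mem_singleton_iff.1 this] at hb'
        exact hb'
    rw [hpalOrder b hb, bilateralOrder, hB, hR1,
      Set.ncard_image_of_injective _ (fun a a' h => by simpa using h)]
    omega
  · have hL1 : (Lext u w).ncard = 1 := by
      by_contra hL1
      exact h ⟨hw, by omega, by omega⟩
    obtain ⟨a, ha⟩ := Set.ncard_eq_one.1 hL1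
    have hB : Bext u w = (fun b => a :: (w ++ [b])) '' Rext u w := by
      ext v
      constructor
      · rintro ⟨hv, a', b, rfl⟩
        have : a' ∈ Lext u w := mem_language_of_infix hv ⟨[], [b], by simp⟩
        rw [ha] at this
        rw [Set.mem_singleton_iff.1 this] at hv ⊢
        exact ⟨b, mem_language_of_infix hv ⟨[a], [], by simp⟩, rfl⟩
      · rintro ⟨b, hb, rfl⟩
        refine ⟨?_, a, b, rfl⟩
        obtain ⟨a', ha'⟩ := exists_cons_mem hrev (show w ++ [b] ∈ language u from hb)
        have : a' ∈ Lext u w := mem_language_of_infix ha' ⟨[], [b], by simp⟩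
        rw [ha] at this
        rw [Set.mem_singleton_iff.1 this] at ha'
        exact ha'
    have hpal : palOrder u w = 0 := by
      rw [palOrder, if_neg]
      intro hpal
      rw [Rext_eq_Lext_reverse hrev, hpal] at hR1
      exact hR1 hL1
    rw [hpal, bilateralOrder, hB, hL1,
      Set.ncard_image_of_injective _ (fun b b' h => by simpa using h)]
    omega

/-- Nonnegative differences with sum 0 vanish one by one. -/
theorem PropertyP.bilateralOrder_eq_palOrder {u : ℕ → A} (hrev : ClosedUnderReversal u)
    (hC : PropertyC u) (hP : PropertyP u) {w : List A} (hw : w ∈ language u) :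
    bilateralOrder u w = palOrder u w := by
  have hR := hP.palindromicReturns hrev hC
  have hsum : ∑ v ∈ factors u w.length, (bilateralOrder u v - palOrder u v) = 0 := by
    rw [Finset.sum_sub_distrib, hC.sum_bilateralOrder, sum_palOrder]
    have h1 := hP w.length
    have h2 := hP (w.length + 1)
    rw [show w.length + 1 + 1 = w.length + 2 by omega] at h2
    omega
  rw [Finset.sum_eq_zero_iff_of_nonneg fun v hv => sub_nonneg.2
    (hR.palOrder_le_bilateralOrder hrev (mem_factors.1 hv).1)] at hsum
  exact sub_eq_zero.1 (hsum w (mem_factors.2 ⟨hw, rfl⟩))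

theorem propertyP_of_bilateralOrder_eq_palOrder {u : ℕ → A} (hrev : ClosedUnderReversal u)
    (hC : PropertyC u) (h : ∀ w, IsBispecial u w → bilateralOrder u w = palOrder u w) :
    PropertyP u := by
  have hP : ∀ n, palComplexity u (n + 2) = palComplexity u n := by
    intro n
    have h1 := sum_palOrder u n
    rw [← Finset.sum_congr rfl fun w hw => ?_, hC.sum_bilateralOrder] at h1
    · omega
    · by_cases hb : IsBispecial u w
      · exact h w hb
      · exact bilateralOrder_eq_palOrder_of_not_isBispecial hrev (mem_factors.1 hw).1 hb
  -- The two-step recurrence `hP` only makes P(n) + P(n+1) constant; its value comes from P(0) =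
  -- C(0) and P(1) = C(1).
  have hsmall : ∀ n ≤ 1, palComplexity u n = factorComplexity u n := by
    intro n hn
    rw [← card_nonpalFactors, nonpalFactors, Finset.filter_eq_empty_iff.2]
    · simp
    · intro w hw
      have hl := (mem_factors.1 hw).2
      match w with
      | [] => simp
      | [a] => simp
      | _ :: _ :: _ => simp at hl; omega
  intro n
  induction n with
  | zero =>
    have h0 := hC 0
    have h1 := hC.factorComplexity_succ 0
    rw [hsmall 0 (by omega), hsmall (0 + 1) (by omega)]
    simp at h0
    omega
  | succ n ih =>
    rw [show n + 1 + 1 = n + 2 by omega, hP n]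
    omega

end

end InfWord

theorem mainTheorem3 {A : Type*} [Fintype A] (u : ℕ → A) (hu : Function.Surjective u)
    (hrev : InfWord.ClosedUnderReversal u) (hC : InfWord.PropertyC u) :
    (InfWord.PropertyP u ↔
      ∀ w : List A, InfWord.IsBispecial u w →
        (¬ w.Palindrome → InfWord.bilateralOrder u w = 0) ∧
        (w.Palindrome →
          InfWord.bilateralOrder u w = ((InfWord.Pext u w).ncard : ℤ) - 1)) ∧
    (InfWord.PropertyP u ↔ InfWord.IsRich u) := by
  refine ⟨⟨fun hP w hw => ?_, fun h => ?_⟩, ?_⟩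
  · exact (InfWord.bilateralOrder_conditions_iff w).2 (hP.bilateralOrder_eq_palOrder hrev hC hw.1)
  · exact InfWord.propertyP_of_bilateralOrder_eq_palOrder hrev hC fun w hw =>
      (InfWord.bilateralOrder_conditions_iff w).1 (h w hw)
  · rw [InfWord.isRich_iff_palindromicReturns]
    exact ⟨fun hP => hP.palindromicReturns hrev hC, fun hR => hR.propertyP hrev hC⟩
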